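/- Let $G$ be a group with a Garside structure $(G,P,\Delta)$ of finite type: $P$ is a submonoid with $P\cap P^{-1}=\{1\}$ and $\Delta\in P$; the partial order $a\preccurlyeq b\Leftrightarrow a^{-1}b\in P$ ("$a$ is a prefix of $b$") is a lattice order on $G$, with greatest common divisors $a\wedge b$; the set $[1,\Delta]=\{s : 1\preccurlyeq s\preccurlyeq\Delta\}$ is finite and generates $G$; $\Delta^{-1}P\Delta=P$; and for each $p\in P\setminus\{1\}$ the lengths of the decompositions of $p$ as a product of elements of $P\setminus\{1\}$ are bounded. An atom is an element $a\in P\setminus\{1\}$ such that $a=bc$ with $b,c\in P$ implies $b=1$ or $c=1$. Write $y^c=c^{-1}yc$; let $\inf(y)$ be the maximal and $\sup(y)$ the minimal integer with $\Delta^{\inf(y)}\preccurlyeq y\preccurlyeq\Delta^{\sup(y)}$; let $\mathfrak p(y)=y\Delta^{-\inf(y)}\wedge y^{-1}\Delta^{\sup(y)}\wedge\Delta$ be the preferred prefix of $y$ and $\mathfrak s(y)=y^{\mathfrak p(y)}$ its cyclic sliding. For $x\in G$, let $\mathrm{SSS}(x)$ be the set of conjugates of $x$ for which $\inf$ is maximal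 and $\sup$ is minimal in the conjugacy class of $x$, and let $\mathrm{SC}(x)$ be the set of conjugates $y$ of $x$ with $\mathfrak s^m(y)=y$ for some $m\ge1$. The iterated transports of $u\in G$ at $y$ are $u^{(0)}=u$ and $u^{(i+1)}=\mathfrak p(y_i)^{-1}\,u^{(i)}\,\mathfrak p\big(y_i^{u^{(i)}}\big)$, where $y_i=\mathfrak s^i(y)$. Let $x\in G$, let $v\in\mathrm{SC}(x)$, and let $a$ be an atom with $a\not\preccurlyeq\mathfrak p(v)$. Let $\rho_a$ be the $\preccurlyeq$-least element $u$ with $a\preccurlyeq u$ and $v^u\in\mathrm{SSS}(x)$, and let $c_a$ be the $\preccurlyeq$-least element $u$ with $a\preccurlyeq u$ and $v^u\in\mathrm{SC}(x)$. Let $N$ be the least positive integer with $\mathfrak s^N(v)=v$, and let $F(\rho_a)=\{\rho_a^{(iN)} : i_1\le i<i_2\}$, where $i_1<i_2$ are the minimal nonnegative integers with $\rho_a^{(i_1N)}=\rho_a^{(i_2N)}$ (transports at $v$). Then $\rho_a$ and $c_a$ exist, the sequence $(\rho_a^{(iN)})_{i\ge0}$ has a repetition (so $F(\rho_a)$ is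 well defined), and either $F(\rho_a)\ne\{1\}$, or $c_a$ is not an indecomposable conjugator starting at $v$. Here $s\in G$ is an indecomposable conjugator starting at $v$ if $s\ne1$ and there is no $t\in G$ with $1\prec t\prec s$ and $v^t\in\mathrm{SC}(x)$. -/

import Mathlib

/-- A Garside structure `(G, P, Δ)` on a group `G`. -/
structure GarsideStructure (G : Type*) [Group G] where
  /-- the monoid of positive elements -/
  P : Submonoid G
  /-- the Garside element -/
  Δ : G
  Δ_mem : Δ ∈ P
  /-- `P ∩ P⁻¹ = {1}` -/
  eq_one_of_mem_of_inv_mem : ∀ a : G, a ∈ P → a⁻¹ ∈ P → a = 1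
  /-- any two elements have a greatest common divisor for `a ≼ b ↔ a⁻¹ * b ∈ P` -/
  exists_gcd : ∀ a b : G, ∃ m : G, (m⁻¹ * a ∈ P ∧ m⁻¹ * b ∈ P) ∧
    ∀ d : G, d⁻¹ * a ∈ P → d⁻¹ * b ∈ P → d⁻¹ * m ∈ P
  /-- any two elements have a least common multiple for `≼` -/
  exists_lcm : ∀ a b : G, ∃ m : G, (a⁻¹ * m ∈ P ∧ b⁻¹ * m ∈ P) ∧
    ∀ d : G, a⁻¹ * d ∈ P → b⁻¹ * d ∈ P → m⁻¹ * d ∈ P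
  /-- the simple elements `{s | 1 ≼ s ≼ Δ}` generate `G` as a group -/
  closure_simples : Subgroup.closure {s : G | s ∈ P ∧ s⁻¹ * Δ ∈ P} = ⊤
  /-- `Δ⁻¹ P Δ = P` -/
  conj_Δ_mem_iff : ∀ a : G, Δ⁻¹ * a * Δ ∈ P ↔ a ∈ P
  /-- the lengths of the decompositions of `x ∈ P \ {1}` into elements of `P \ {1}` are bounded -/
  norm_finite : ∀ x : G, x ∈ P → x ≠ 1 →
    BddAbove {k : ℕ | ∃ l : List G, l.length = k ∧ (∀ a ∈ l, a ∈ P ∧ a ≠ 1) ∧ l.prod = x}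

namespace GarsideStructure

variable {G : Type*} [Group G] (S : GarsideStructure G)

/-- The prefix order `a ≼ b`. -/
def le (a b : G) : Prop := a⁻¹ * b ∈ S.P

/-- The strict prefix order `a ≺ b`. -/
def lt (a b : G) : Prop := S.le a b ∧ a ≠ b

/-- The set `[1, Δ]` of simple elements. -/
def simples : Set G := {s | S.le 1 s ∧ S.le s S.Δ}

/-- The structure is of finite type if it has finitely many simple elements. -/
def IsFiniteType : Prop := S.simples.Finite

/-- Atoms: the nontrivial positive elements that cannot be decomposed in `P`. -/
def IsAtom (a : G) : Prop :=
  a ∈ S.P ∧ a ≠ 1 ∧ ∀ b ∈ S.P, ∀ c ∈ S.P, a = b * c → b = 1 ∨ c = 1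

/-- The greatest common divisor `a ∧ b` with respect to `≼`. -/
noncomputable def gcd (a b : G) : G := (S.exists_gcd a b).choose

/-- `inf x` is the maximal integer `k` with `Δ ^ k ≼ x`. -/
noncomputable def inf (x : G) : ℤ := sSup {k : ℤ | S.le (S.Δ ^ k) x}

/-- `sup x` is the minimal integer `k` with `x ≼ Δ ^ k`. -/
noncomputable def sup (x : G) : ℤ := sInf {k : ℤ | S.le x (S.Δ ^ k)}

/-- The conjugate `x ^ c = c⁻¹ x c`. -/
def conjBy (x c : G) : G := c⁻¹ * x * c

/-- The super summit set of `x`: the conjugates `y` of `x` such that `inf y` is the maximum of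
`inf` and `sup y` is the minimum of `sup` on the conjugacy class of `x`. -/
def SSS (x : G) : Set G :=
  {y | IsConj x y ∧ IsGreatest (S.inf '' {z | IsConj x z}) (S.inf y) ∧
    IsLeast (S.sup '' {z | IsConj x z}) (S.sup y)}

/-- The preferred prefix `𝔭(x) = (x Δ^(-inf x)) ∧ (x⁻¹ Δ^(sup x)) ∧ Δ`. -/
noncomputable def preferredPrefix (x : G) : G :=
  S.gcd (S.gcd (x * S.Δ ^ (-S.inf x)) (x⁻¹ * S.Δ ^ S.sup x)) S.Δ

/-- Cyclic sliding: the conjugate of `x` by its preferred prefix. -/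
noncomputable def slide (x : G) : G := conjBy x (S.preferredPrefix x)

/-- The set of sliding circuits of `x`. -/
def SC (x : G) : Set G := {y | IsConj x y ∧ ∃ m : ℕ, 1 ≤ m ∧ S.slide^[m] y = y}

/-- The transport of `α` at `x` under cyclic sliding. -/
noncomputable def transport (x α : G) : G :=
  (S.preferredPrefix x)⁻¹ * α * S.preferredPrefix (conjBy x α)

/-- The iterated transport `α^(i)` of `α` at `x`. -/
noncomputable def iterTransport (x α : G) : ℕ → G
  | 0 => α
  | i + 1 => S.transport (S.slide^[i] x) (iterTransport x α i)

/-- For `y` in a sliding circuit, of length `N`, the transport `u^(iN)` at `y`. -/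
noncomputable def circuitTransport (y u : G) (i : ℕ) : G :=
  S.iterTransport y u (i * Function.minimalPeriod S.slide y)

/-- The minimal `i₁` such that `u^(i₁N) = u^(jN)` for some `j > i₁`. -/
noncomputable def firstIndex (y u : G) : ℕ :=
  sInf {i | ∃ j, i < j ∧ S.circuitTransport y u i = S.circuitTransport y u j}

/-- The minimal `i₂ > i₁` such that `u^(i₁N) = u^(i₂N)`. -/
noncomputable def secondIndex (y u : G) : ℕ :=
  sInf {j | S.firstIndex y u < j ∧
    S.circuitTransport y u (S.firstIndex y u) = S.circuitTransport y u j}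

/-- The periodic transport set `F(u) = {u^(iN) | i₁ ≤ i < i₂}` at `y`. -/
noncomputable def F (y u : G) : Set G :=
  {w | ∃ i, S.firstIndex y u ≤ i ∧ i < S.secondIndex y u ∧ w = S.circuitTransport y u i}

/-- `m` is the `≼`-least element of `A`. -/
def IsLeastIn (A : Set G) (m : G) : Prop := m ∈ A ∧ ∀ u ∈ A, S.le m u

open Classical in
/-- The `≼`-least element of `A`; it is `1` if there is none. -/
noncomputable def least (A : Set G) : G :=
  if h : ∃ m, S.IsLeastIn A m then h.choose else 1

/-- The elements with prefix `s` that conjugate `y` into the super summit set of `x`. -/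
def toSSS (x y s : G) : Set G := {u | S.le s u ∧ conjBy y u ∈ S.SSS x}

/-- The elements with prefix `s` that conjugate `y` into the set of sliding circuits of `x`. -/
def toSC (x y s : G) : Set G := {u | S.le s u ∧ conjBy y u ∈ S.SC x}

/-- `ρ_s`: the `≼`-least `u` with `s ≼ u` and `y ^ u ∈ SSS(x)`. -/
noncomputable def rho (x y s : G) : G := S.least (S.toSSS x y s)

/-- `c_s`: the `≼`-least `u` with `s ≼ u` and `y ^ u ∈ SC(x)`. -/
noncomputable def cmin (x y s : G) : G := S.least (S.toSC x y s)

/-- `s` is an indecomposable conjugator starting at `y ∈ SC(x)`. -/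
def IsIndecomposableConjugator (x y s : G) : Prop :=
  s ≠ 1 ∧ ¬ ∃ t : G, S.lt 1 t ∧ S.lt t s ∧ conjBy y t ∈ S.SC x

end GarsideStructure

/-! Suppose `F(ρ_a) = {1}` and `c_a` is indecomposable. Conjugators from `v` into `SC(x)` are closed
under `∧`, so `d = c_a ∧ 𝔭(v)` is one. It differs from `c_a` because `a ≼ c_a` and `a ⋠ 𝔭(v)`; hence
`d = 1`. Since `SC(x) ⊆ SSS(x)`, `ρ_a ≼ c_a`, and so `ρ_a ∧ 𝔭(v) = 1`. Transport respects `∧` and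
sends `𝔭(v)` to `𝔭(𝔰(v))`, so each `ρ_a^(i)` meets `𝔭(v_i)` trivially. If `ρ_a^(i+1) = 1`, then
`ρ_a^(i) ≼ 𝔭(v_i)`, so already `ρ_a^(i) = 1`. Descending, `ρ_a = 1`, which contradicts `1 ≠ a ≼ ρ_a`
(`iterTransport_ne_one`).

Behind this stand three facts. On `SSS(x)` the integers `inf` and `sup` are constant, and with them
fixed `u ↦ u * 𝔭(y^u)` preserves `∧` (`mul_prefixWith_gcd`). Sliding circuits lie in `SSS(x)`
(`SC_subset_SSS`), by comparing sliding with cycling. Transports of a positive `u` stay in a finite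
interval `[1, Δ^n]`, so they repeat; this gives `conjBy_gcd_mem_SC`. -/

namespace GarsideStructure

variable {G : Type*} [Group G] (S : GarsideStructure G)

/-! ### The prefix order -/

theorem le_refl (a : G) : S.le a a := by simp [le, S.P.one_mem]

variable {S} in
theorem le.trans {a b c : G} (h : S.le a b) (h' : S.le b c) : S.le a c := by
  have := S.P.mul_mem h h'
  simpa [le, mul_assoc] using this

variable {S} in
theorem le.antisymm {a b : G} (h : S.le a b) (h' : S.le b a) : a = b := by
  have := S.eq_one_of_mem_of_inv_mem _ h (by simpa [le] using h')
  exact inv_mul_eq_one.1 this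

theorem one_le {a : G} : S.le 1 a ↔ a ∈ S.P := by simp [le]

theorem mul_le_mul_left_iff (c a b : G) : S.le (c * a) (c * b) ↔ S.le a b := by
  simp [le, mul_assoc]

variable {S} in
theorem le.mul_left {a b : G} (h : S.le a b) (c : G) : S.le (c * a) (c * b) :=
  (S.mul_le_mul_left_iff c a b).2 h

theorem zpow_conj_mem_iff (n : ℤ) (a : G) : (S.Δ ^ n)⁻¹ * a * S.Δ ^ n ∈ S.P ↔ a ∈ S.P := by
  induction n generalizing a with
  | zero => simp
  | succ n ih =>
    rw [← ih a, ← S.conj_Δ_mem_iff ((S.Δ ^ (n : ℤ))⁻¹ * a * _)]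
    simp only [zpow_add_one, mul_inv_rev, mul_assoc]
  | pred n ih =>
    rw [← ih a, ← S.conj_Δ_mem_iff ((S.Δ ^ (-(n : ℤ) - 1))⁻¹ * a * _)]
    simp only [zpow_sub_one, mul_inv_rev, mul_assoc, inv_inv, inv_mul_cancel, mul_one,
      inv_mul_cancel_left]

theorem mul_zpow_le_iff (n : ℤ) (a b : G) : S.le (a * S.Δ ^ n) (b * S.Δ ^ n) ↔ S.le a b := by
  unfold le
  rw [← S.zpow_conj_mem_iff n (a⁻¹ * b)]
  simp only [mul_inv_rev, mul_assoc]

variable {S} in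
theorem le.mul_zpow {a b : G} (h : S.le a b) (n : ℤ) : S.le (a * S.Δ ^ n) (b * S.Δ ^ n) :=
  (S.mul_zpow_le_iff n a b).2 h

theorem zpow_mem {n : ℤ} (hn : 0 ≤ n) : S.Δ ^ n ∈ S.P := by
  lift n to ℕ using hn
  simpa using S.P.pow_mem S.Δ_mem n

theorem zpow_le_zpow {m n : ℤ} (h : m ≤ n) : S.le (S.Δ ^ m) (S.Δ ^ n) := by
  have := S.zpow_mem (sub_nonneg.2 h)
  rwa [le, ← zpow_neg, ← zpow_add, neg_add_eq_sub]

theorem mul_zpow_le_mul_zpow (a : G) {m n : ℤ} (h : m ≤ n) :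
    S.le (a * S.Δ ^ m) (a * S.Δ ^ n) := (S.zpow_le_zpow h).mul_left a

theorem zpow_le_conjBy_iff (n : ℤ) (y u : G) :
    S.le (S.Δ ^ n) (conjBy y u) ↔ S.le (u * S.Δ ^ n) (y * u) := by
  rw [← S.mul_le_mul_left_iff u]
  simp [conjBy, mul_assoc]

theorem conjBy_le_zpow_iff (n : ℤ) (y u : G) :
    S.le (conjBy y u) (S.Δ ^ n) ↔ S.le (y * u) (u * S.Δ ^ n) := by
  rw [← S.mul_le_mul_left_iff u]
  simp [conjBy, mul_assoc]

theorem zpow_le_inv_iff (n : ℤ) (y : G) : S.le (S.Δ ^ n) y⁻¹ ↔ S.le y (S.Δ ^ (-n)) := by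
  rw [← S.mul_zpow_le_iff n y, ← S.mul_le_mul_left_iff y]
  simp

theorem inv_le_zpow_iff (n : ℤ) (y : G) : S.le y⁻¹ (S.Δ ^ n) ↔ S.le (S.Δ ^ (-n)) y := by
  rw [← S.mul_zpow_le_iff n (S.Δ ^ (-n)), ← S.mul_le_mul_left_iff y]
  simp

/-! ### Greatest common divisors -/

theorem gcd_le_left (a b : G) : S.le (S.gcd a b) a := (S.exists_gcd a b).choose_spec.1.1

theorem gcd_le_right (a b : G) : S.le (S.gcd a b) b := (S.exists_gcd a b).choose_spec.1.2

variable {S} in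
theorem le_gcd {a b d : G} (ha : S.le d a) (hb : S.le d b) : S.le d (S.gcd a b) :=
  (S.exists_gcd a b).choose_spec.2 d ha hb

theorem le_gcd_iff {a b d : G} : S.le d (S.gcd a b) ↔ S.le d a ∧ S.le d b :=
  ⟨fun h => ⟨h.trans (S.gcd_le_left a b), h.trans (S.gcd_le_right a b)⟩, fun h => le_gcd h.1 h.2⟩

variable {S} in
theorem eq_of_forall_le_iff {a b : G} (h : ∀ d, S.le d a ↔ S.le d b) : a = b :=
  ((h a).1 (S.le_refl a)).antisymm ((h b).2 (S.le_refl b))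

theorem gcd_comm (a b : G) : S.gcd a b = S.gcd b a :=
  eq_of_forall_le_iff (S := S) fun d => by simp only [le_gcd_iff, and_comm]

theorem mul_gcd (c a b : G) : c * S.gcd a b = S.gcd (c * a) (c * b) :=
  eq_of_forall_le_iff (S := S) fun d => by
    have h (x : G) : S.le d (c * x) ↔ S.le (c⁻¹ * d) x := by
      rw [← S.mul_le_mul_left_iff c (c⁻¹ * d), mul_inv_cancel_left]
    simp only [le_gcd_iff, h]

theorem gcd_mul_zpow (a b : G) (n : ℤ) :
    S.gcd a b * S.Δ ^ n = S.gcd (a * S.Δ ^ n) (b * S.Δ ^ n) :=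
  eq_of_forall_le_iff (S := S) fun d => by
    have h (x : G) : S.le d (x * S.Δ ^ n) ↔ S.le (d * S.Δ ^ (-n)) x := by
      rw [← S.mul_zpow_le_iff n _ x]
      simp
    simp only [le_gcd_iff, h]

theorem gcd_eq_left {a b : G} (h : S.le a b) : S.gcd a b = a :=
  (S.gcd_le_left a b).antisymm (le_gcd (S.le_refl a) h)

/-! ### The length of positive elements -/

/-- The maximal length of a decomposition into nontrivial positive elements. -/
noncomputable def norm (x : G) : ℕ :=
  sSup {k : ℕ | ∃ l : List G, l.length = k ∧ (∀ a ∈ l, a ∈ S.P ∧ a ≠ 1) ∧ l.prod = x}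

theorem eq_one_of_mul_eq_one {a b : G} (ha : a ∈ S.P) (hb : b ∈ S.P) (h : a * b = 1) :
    a = 1 :=
  S.eq_one_of_mem_of_inv_mem a ha (by rwa [inv_eq_of_mul_eq_one_right h])

theorem bddAbove_lengths {x : G} (hx : x ∈ S.P) :
    BddAbove {k : ℕ | ∃ l : List G, l.length = k ∧ (∀ a ∈ l, a ∈ S.P ∧ a ≠ 1) ∧ l.prod = x} := by
  by_cases h1 : x = 1
  · refine ⟨0, ?_⟩
    rintro k ⟨l, rfl, hl, hp⟩
    cases l with
    | nil => simp
    | cons b l =>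
      have hb := hl b (by simp)
      have hlP : l.prod ∈ S.P := S.P.list_prod_mem fun c hc => (hl c (by simp [hc])).1
      rw [List.prod_cons, h1] at hp
      exact absurd (S.eq_one_of_mul_eq_one hb.1 hlP hp) hb.2
  · exact S.norm_finite x hx h1

theorem norm_lt_norm_mul {a b : G} (ha : a ∈ S.P) (hb : b ∈ S.P) (hb1 : b ≠ 1) :
    S.norm a < S.norm (a * b) := by
  have hne : {k : ℕ | ∃ l : List G, l.length = k ∧ (∀ c ∈ l, c ∈ S.P ∧ c ≠ 1) ∧
      l.prod = a}.Nonempty := by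
    by_cases h1 : a = 1
    · exact ⟨0, [], by simp [h1]⟩
    · exact ⟨1, [a], by simp [ha, h1]⟩
  obtain ⟨l, hl, hlP, hp⟩ := Nat.sSup_mem hne (S.bddAbove_lengths ha)
  refine Nat.lt_of_succ_le (le_csSup (S.bddAbove_lengths (S.P.mul_mem ha hb)) ⟨l ++ [b], ?_, ?_, ?_⟩)
  · simp [hl, norm]
  · intro c hc
    rcases List.mem_append.1 hc with hc | hc
    · exact hlP c hc
    · rw [List.mem_singleton.1 hc]
      exact ⟨hb, hb1⟩
  · simp [hp]

/-- A nonempty set of positive elements that is closed under `∧` has a least element. -/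
theorem exists_isLeastIn {A : Set G} (hne : A.Nonempty) (hA : ∀ u ∈ A, u ∈ S.P)
    (hgcd : ∀ u ∈ A, ∀ w ∈ A, S.gcd u w ∈ A) : ∃ m, S.IsLeastIn A m := by
  -- If an element `m` of minimal norm were not below some `w`, then `m ∧ w` would be a proper
  -- prefix of `m` in `A`, of smaller norm.
  obtain ⟨m, hm, hmin⟩ := exists_minimalFor_of_wellFoundedLT (· ∈ A) S.norm hne
  refine ⟨m, hm, fun w hw => ?_⟩
  by_contra hle
  have hd := hgcd m hm w hw
  have hlt := S.norm_lt_norm_mul (hA _ hd) (S.gcd_le_left m w) (fun h => hle (by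
    have := S.gcd_le_right m w
    rwa [inv_mul_eq_one.1 h] at this))
  rw [mul_inv_cancel_left] at hlt
  exact absurd (hmin hd hlt.le) (not_le.2 hlt)

theorem isLeastIn_least {A : Set G} (h : ∃ m, S.IsLeastIn A m) : S.IsLeastIn A (S.least A) := by
  rw [least, dif_pos h]
  exact h.choose_spec

/-! ### Infimum and supremum -/

theorem exists_zpow_bounds (x : G) : ∃ p q : ℤ, S.le (S.Δ ^ p) x ∧ S.le x (S.Δ ^ q) := by
  have hx : x ∈ Subgroup.closure {s : G | s ∈ S.P ∧ s⁻¹ * S.Δ ∈ S.P} := by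
    rw [S.closure_simples]
    trivial
  induction hx using Subgroup.closure_induction with
  | mem s hs => exact ⟨0, 1, by simpa [le] using hs.1, by simpa [le] using hs.2⟩
  | one => exact ⟨0, 0, by simpa using S.le_refl 1, by simpa using S.le_refl 1⟩
  | mul x y _ _ hx hy =>
    obtain ⟨p, q, hp, hq⟩ := hx
    obtain ⟨p', q', hp', hq'⟩ := hy
    refine ⟨p + p', q + q', ?_, ?_⟩ <;> rw [zpow_add]
    · exact (hp.mul_zpow p').trans (hp'.mul_left x)
    · exact (hq'.mul_left x).trans (hq.mul_zpow q')
  | inv x _ hx =>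
    obtain ⟨p, q, hp, hq⟩ := hx
    exact ⟨-q, -p, by rwa [zpow_le_inv_iff, neg_neg], by rwa [inv_le_zpow_iff, neg_neg]⟩

theorem Δ_ne_one [Nontrivial G] : S.Δ ≠ 1 := by
  intro hΔ
  obtain ⟨x, hx⟩ := exists_ne (1 : G)
  obtain ⟨p, q, hp, hq⟩ := S.exists_zpow_bounds x
  rw [hΔ, one_zpow] at hp hq
  exact hx (hq.antisymm hp)

theorem zpow_le_zpow_iff [Nontrivial G] {m n : ℤ} : S.le (S.Δ ^ m) (S.Δ ^ n) ↔ m ≤ n := by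
  refine ⟨fun h => ?_, S.zpow_le_zpow⟩
  by_contra hlt
  have h1 : S.le (S.Δ ^ (n + 1)) (S.Δ ^ n) := (S.zpow_le_zpow (by omega)).trans h
  have h2 := (S.zpow_le_zpow (show n ≤ n + 1 by omega)).antisymm h1
  rw [zpow_add_one] at h2
  exact S.Δ_ne_one (mul_eq_left.1 h2.symm)

/-- Nontriviality gives `Δ` infinite order. In the trivial group the set defining `inf` is all of
`ℤ` and its supremum is a default value. -/
theorem le_inf_iff [Nontrivial G] {n : ℤ} {x : G} : n ≤ S.inf x ↔ S.le (S.Δ ^ n) x := by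
  obtain ⟨p, q, hp, hq⟩ := S.exists_zpow_bounds x
  have hb : BddAbove {k : ℤ | S.le (S.Δ ^ k) x} :=
    ⟨q, fun k hk => S.zpow_le_zpow_iff.1 (hk.trans hq)⟩
  exact ⟨fun h => (S.zpow_le_zpow h).trans (Int.csSup_mem ⟨p, hp⟩ hb), fun h => le_csSup hb h⟩

theorem sup_le_iff [Nontrivial G] {n : ℤ} {x : G} : S.sup x ≤ n ↔ S.le x (S.Δ ^ n) := by
  obtain ⟨p, q, hp, hq⟩ := S.exists_zpow_bounds x
  have hb : BddBelow {k : ℤ | S.le x (S.Δ ^ k)} :=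
    ⟨p, fun k hk => S.zpow_le_zpow_iff.1 (hp.trans hk)⟩
  refine ⟨fun h => ?_, fun h => csInf_le hb h⟩
  have : S.le x (S.Δ ^ S.sup x) := Int.csInf_mem (s := {k : ℤ | S.le x (S.Δ ^ k)}) ⟨q, hq⟩ hb
  exact this.trans (S.zpow_le_zpow h)

theorem inf_inv [Nontrivial G] (x : G) : S.inf x⁻¹ = -S.sup x :=
  _root_.eq_of_forall_le_iff fun n => by
    rw [le_inf_iff, zpow_le_inv_iff, ← sup_le_iff, le_neg]

theorem sup_inv [Nontrivial G] (x : G) : S.sup x⁻¹ = -S.inf x := by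
  rw [← neg_eq_iff_eq_neg, ← inf_inv, inv_inv]

/-! ### Sliding with prescribed bounds -/

theorem isConj_conjBy (x u : G) : IsConj x (conjBy x u) :=
  isConj_iff.2 ⟨u⁻¹, by simp [conjBy]⟩

theorem exists_conjBy_of_isConj {x y : G} (h : IsConj x y) : ∃ u, conjBy x u = y := by
  obtain ⟨c, rfl⟩ := isConj_iff.1 h
  exact ⟨c⁻¹, by simp [conjBy]⟩

theorem conjBy_conjBy (x u w : G) : conjBy (conjBy x u) w = conjBy x (u * w) := by
  simp [conjBy, mul_assoc]

theorem conjBy_one (x : G) : conjBy x 1 = x := by simp [conjBy]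

/-- The preferred prefix with the infimum and the supremum replaced by `p` and `q`. -/
noncomputable def prefixWith (p q : ℤ) (y : G) : G :=
  S.gcd (S.gcd (y * S.Δ ^ (-p)) (y⁻¹ * S.Δ ^ q)) S.Δ

/-- Cyclic sliding with the infimum and the supremum replaced by `p` and `q`. -/
noncomputable def slideWith (p q : ℤ) (y : G) : G := conjBy y (S.prefixWith p q y)

theorem preferredPrefix_eq (y : G) : S.preferredPrefix y = S.prefixWith (S.inf y) (S.sup y) y := rfl

theorem slide_eq (y : G) : S.slide y = S.slideWith (S.inf y) (S.sup y) y := rfl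

/-- For fixed `p`, `q`, `y`, this displays `u ↦ u * 𝔭(y^u)` as a meet of three maps `u ↦ y^ε u Δ^n`
with `ε ∈ {1, -1, 0}`. Each is an automorphism of the lattice, so the lemmas on monotonicity, `∧`,
and multiplication by `Δ^n` or `y` follow. -/
theorem mul_prefixWith_conjBy (p q : ℤ) (y u : G) :
    u * S.prefixWith p q (conjBy y u) =
      S.gcd (S.gcd (y * u * S.Δ ^ (-p)) (y⁻¹ * u * S.Δ ^ q)) (u * S.Δ) := by
  simp [prefixWith, mul_gcd, conjBy, mul_assoc]

theorem mul_prefixWith_mono (p q : ℤ) (y : G) {u w : G} (h : S.le u w) :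
    S.le (u * S.prefixWith p q (conjBy y u)) (w * S.prefixWith p q (conjBy y w)) := by
  simp only [mul_prefixWith_conjBy, le_gcd_iff]
  have hΔ : S.le (u * S.Δ) (w * S.Δ) := by simpa using h.mul_zpow 1
  exact ⟨⟨((S.gcd_le_left _ _).trans (S.gcd_le_left _ _)).trans ((h.mul_left y).mul_zpow _),
    ((S.gcd_le_left _ _).trans (S.gcd_le_right _ _)).trans ((h.mul_left y⁻¹).mul_zpow _)⟩,
    (S.gcd_le_right _ _).trans hΔ⟩

theorem mul_prefixWith_gcd (p q : ℤ) (y u w : G) :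
    S.gcd u w * S.prefixWith p q (conjBy y (S.gcd u w)) =
      S.gcd (u * S.prefixWith p q (conjBy y u)) (w * S.prefixWith p q (conjBy y w)) := by
  have hΔ : S.gcd u w * S.Δ = S.gcd (u * S.Δ) (w * S.Δ) := by
    simpa using S.gcd_mul_zpow u w 1
  simp only [mul_prefixWith_conjBy, hΔ, mul_gcd, gcd_mul_zpow]
  refine eq_of_forall_le_iff (S := S) fun d => ?_
  simp only [le_gcd_iff]
  tauto

theorem mul_zpow_prefixWith (p q : ℤ) (y u : G) (n : ℤ) :
    u * S.Δ ^ n * S.prefixWith p q (conjBy y (u * S.Δ ^ n)) =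
      u * S.prefixWith p q (conjBy y u) * S.Δ ^ n := by
  simp only [mul_prefixWith_conjBy, gcd_mul_zpow]
  simp only [mul_assoc, ← zpow_add, add_comm n, ← zpow_add_one, ← zpow_one_add]

theorem mul_prefixWith_self_mul (p q : ℤ) (y u : G) :
    y * u * S.prefixWith p q (conjBy y (y * u)) = y * (u * S.prefixWith p q (conjBy y u)) := by
  simp only [mul_prefixWith_conjBy, mul_gcd]
  simp [mul_assoc]

theorem prefixWith_inv (p q : ℤ) (y : G) :
    S.prefixWith (-q) (-p) y⁻¹ = S.prefixWith p q y := by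
  simp only [prefixWith, neg_neg, inv_inv]
  rw [S.gcd_comm (y⁻¹ * _)]

theorem slideWith_inv (p q : ℤ) (y : G) :
    S.slideWith (-q) (-p) y⁻¹ = (S.slideWith p q y)⁻¹ := by
  simp [slideWith, prefixWith_inv, conjBy, mul_assoc]

theorem zpow_le_slideWith (p q : ℤ) {r : ℤ} {y : G} (h : S.le (S.Δ ^ r) y) :
    S.le (S.Δ ^ r) (S.slideWith p q y) := by
  have e (a : G) (m n : ℤ) : a * S.Δ ^ m * S.Δ ^ n = a * S.Δ ^ (m + n) := by
    rw [mul_assoc, zpow_add]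
  rw [slideWith, zpow_le_conjBy_iff]
  simp only [prefixWith, gcd_mul_zpow, mul_gcd, e, le_gcd_iff, mul_inv_cancel_left]
  -- With `d` the prefix, `d Δ^r ≼ y d` is checked component by component: each of the three terms
  -- of `d`, times `Δ^r`, lies below `y` times the same term.
  refine ⟨⟨((S.gcd_le_left _ _).trans (S.gcd_le_left _ _)).trans ?_,
    ((S.gcd_le_left _ _).trans (S.gcd_le_right _ _)).trans ?_⟩, (S.gcd_le_right _ _).trans ?_⟩
  · have := (h.mul_zpow (-p)).mul_left y
    rwa [← zpow_add, add_comm] at this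
  · have := (h.mul_zpow q).mul_left y⁻¹
    rwa [← zpow_add, inv_mul_cancel_left, add_comm] at this
  · have := h.mul_zpow 1
    rwa [← zpow_add, add_comm, zpow_add, zpow_one] at this

theorem slideWith_le_zpow (p q : ℤ) {r : ℤ} {y : G} (h : S.le y (S.Δ ^ r)) :
    S.le (S.slideWith p q y) (S.Δ ^ r) := by
  rw [← neg_neg r, ← zpow_le_inv_iff, ← slideWith_inv]
  exact S.zpow_le_slideWith _ _ (by rwa [zpow_le_inv_iff, neg_neg])

theorem slide_inv [Nontrivial G] (y : G) : S.slide y⁻¹ = (S.slide y)⁻¹ := by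
  rw [slide_eq, inf_inv, sup_inv, slideWith_inv, slide_eq]

theorem inf_le_inf_slide [Nontrivial G] (y : G) : S.inf y ≤ S.inf (S.slide y) :=
  S.le_inf_iff.2 (S.zpow_le_slideWith _ _ (S.le_inf_iff.1 _root_.le_rfl))

theorem sup_slide_le_sup [Nontrivial G] (y : G) : S.sup (S.slide y) ≤ S.sup y :=
  S.sup_le_iff.2 (S.slideWith_le_zpow _ _ (S.sup_le_iff.1 _root_.le_rfl))

/-! ### Cycling -/

/-- The conjugating element of cycling, with the infimum replaced by `p` and normalised by a
power of `Δ` so that it is a prefix of `1`. -/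
noncomputable def cycler (p : ℤ) (y : G) : G := S.gcd (y * S.Δ ^ (-(p + 1))) 1

/-- Cycling, with the infimum replaced by `p`. -/
noncomputable def cycle (p : ℤ) (y : G) : G := conjBy y (S.cycler p y)

theorem cycle_le_zpow (p : ℤ) {q : ℤ} {y : G} (h : S.le y (S.Δ ^ q)) :
    S.le (S.cycle p y) (S.Δ ^ q) := by
  rw [cycle, conjBy_le_zpow_iff]
  simp only [cycler, gcd_mul_zpow, mul_gcd, le_gcd_iff, mul_one, one_mul]
  refine ⟨(S.gcd_le_left _ _).trans ?_, (S.gcd_le_right _ _).trans h⟩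
  have := (h.mul_zpow (-(p + 1))).mul_left y
  rwa [(Commute.refl S.Δ).zpow_zpow q, ← mul_assoc y _ (S.Δ ^ q)] at this

/-- The map `u ↦ u * 𝔭(y^u)` commutes with `∧`, with left multiplication by `y` and with right
multiplication by powers of `Δ`. The cycler is built from `1` by these operations. Hence cycling and
sliding commute (`slideWith_cycle`). -/
theorem prefixWith_mul_cycler_slideWith (p q : ℤ) (y : G) :
    S.prefixWith p q y * S.cycler p (S.slideWith p q y) =
      S.cycler p y * S.prefixWith p q (S.cycle p y) := by
  have h1 := S.mul_prefixWith_self_mul p q y 1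
  have h2 := S.mul_zpow_prefixWith p q y (y * 1) (-(p + 1))
  rw [h1] at h2
  simp only [mul_one, one_mul, conjBy_one] at h2
  rw [cycle, cycler, cycler, mul_prefixWith_gcd, h2, mul_gcd]
  simp [slideWith, conjBy, mul_assoc]

theorem slideWith_cycle (p q : ℤ) (y : G) :
    S.slideWith p q (S.cycle p y) = S.cycle p (S.slideWith p q y) := by
  rw [slideWith, cycle, conjBy_conjBy, ← cycle, ← prefixWith_mul_cycler_slideWith, cycle,
    ← conjBy_conjBy, ← slideWith]

/-- Any `u ≼ 1` that raises the infimum satisfies `u ≼ h ≼ 1` for the cycler `h`. Cycling thus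
absorbs part of `u`: the remaining conjugator is `h⁻¹ u`, whose inverse has smaller norm unless `h =
1`. -/
theorem exists_zpow_le_iterate_cycle (p : ℤ) (y u : G) (hu : S.le u 1)
    (huy : S.le (u * S.Δ ^ (p + 1)) (y * u)) :
    ∃ k : ℕ, S.le (S.Δ ^ (p + 1)) ((S.cycle p)^[k] y) := by
  induction hn : S.norm u⁻¹ using Nat.strong_induction_on generalizing y u with
  | _ n ih =>
    subst hn
    set h := S.cycler p y with hh
    have huh : S.le u h := by
      refine le_gcd ?_ hu
      have := (huy.trans (hu.mul_left y)).mul_zpow (-(p + 1))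
      simpa only [mul_assoc, ← zpow_add, add_neg_cancel, zpow_zero, mul_one] using this
    have hh1 : S.le h 1 := S.gcd_le_right _ _
    by_cases h1 : h = 1
    · refine ⟨0, ?_⟩
      have : S.le 1 (y * S.Δ ^ (-(p + 1))) := h1 ▸ S.gcd_le_left _ _
      simpa only [mul_assoc, ← zpow_add, neg_add_cancel, zpow_zero, mul_one, one_mul,
        Function.iterate_zero, id] using this.mul_zpow (p + 1)
    · have hlt := S.norm_lt_norm_mul (a := u⁻¹ * h) (b := h⁻¹) huh (by simpa [le] using hh1)
        (by simpa using h1)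
      rw [mul_inv_cancel_right] at hlt
      obtain ⟨k, hk⟩ := ih _ hlt (S.cycle p y) (h⁻¹ * u)
        (by simpa using huh.mul_left h⁻¹)
        (by simpa [cycle, conjBy, mul_assoc, ← hh] using huy.mul_left h⁻¹) (by simp)
      exact ⟨k + 1, hk⟩

theorem zpow_le_slideWith_of_zpow_le_cycle (p q : ℤ) {y : G} (hy : S.le y (S.Δ ^ q))
    (h : S.le (S.Δ ^ (p + 1)) (S.cycle p y)) : S.le (S.Δ ^ (p + 1)) (S.slideWith p q y) := by
  rw [cycle, zpow_le_conjBy_iff] at h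
  -- In this case the middle component of the prefix causes no obstruction, because `Δ^(p+2) ≼ Δ^q`.
  -- Otherwise `y ≼ Δ^(p+1)`, the cycler is `y Δ^(-(p+1))`, and the hypothesis already says `Δ^(p+1)
  -- ≼ y`.
  by_cases hq : p + 2 ≤ q
  · have h1 : S.le (S.cycler p y) 1 := S.gcd_le_right _ _
    have h2 : S.le (S.cycler p y * S.Δ ^ (p + 2)) (y * (S.cycler p y * S.Δ)) := by
      have := h.mul_zpow 1
      simp only [mul_assoc, ← zpow_add] at this
      simpa [add_assoc] using this
    have hc : S.cycler p y * S.Δ = S.gcd (y * S.Δ ^ (-p)) S.Δ := by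
      have := S.gcd_mul_zpow (y * S.Δ ^ (-(p + 1))) 1 1
      rw [mul_assoc, ← zpow_add] at this
      simpa [cycler] using this
    have hp : S.le (S.prefixWith p q y) (S.cycler p y * S.Δ) := by
      rw [hc]
      exact le_gcd ((S.gcd_le_left _ _).trans (S.gcd_le_left _ _)) (S.gcd_le_right _ _)
    have h3 : S.le (S.prefixWith p q y * S.Δ ^ (p + 1)) (S.cycler p y * S.Δ ^ (p + 2)) := by
      have := hp.mul_zpow (p + 1)
      rwa [mul_assoc, ← zpow_one_add, show 1 + (p + 1) = p + 2 by ring] at this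
    have h4 := h2
    rw [hc] at h4
    rw [slideWith, zpow_le_conjBy_iff]
    refine h3.trans ?_
    rw [prefixWith, mul_gcd, mul_gcd, mul_inv_cancel_left]
    refine le_gcd (le_gcd (h4.trans ((S.gcd_le_left _ _).mul_left y)) ?_)
      (h4.trans ((S.gcd_le_right _ _).mul_left y))
    exact (h1.mul_zpow (p + 2)).trans (by simpa using S.zpow_le_zpow hq)
  · have hy' : S.le y (S.Δ ^ (p + 1)) := hy.trans (S.zpow_le_zpow (by omega))
    have hc : S.cycler p y = y * S.Δ ^ (-(p + 1)) :=
      S.gcd_eq_left (by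
        have := hy'.mul_zpow (-(p + 1))
        rwa [← zpow_add, add_neg_cancel, zpow_zero] at this)
    rw [hc] at h
    apply S.zpow_le_slideWith
    have := (h.mul_left y⁻¹).mul_zpow (p + 1)
    simpa only [mul_assoc, ← zpow_add, neg_add_cancel, zpow_zero, mul_one, inv_mul_cancel_left,
      inv_mul_cancel, one_mul, add_neg_cancel, neg_add_cancel_left] using this

/-- By commutation, a slide can replace the last cycling and be moved innermost, so the cyclings are
exchanged for slides one at a time. -/
theorem zpow_le_iterate_slideWith (p q : ℤ) (k : ℕ) {y : G} (hy : S.le y (S.Δ ^ q))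
    (h : S.le (S.Δ ^ (p + 1)) ((S.cycle p)^[k] y)) :
    S.le (S.Δ ^ (p + 1)) ((S.slideWith p q)^[k] y) := by
  induction k generalizing y with
  | zero => exact h
  | succ k ih =>
    have hk : S.le ((S.cycle p)^[k] y) (S.Δ ^ q) :=
      Function.Iterate.rec (fun z => S.le z (S.Δ ^ q)) hy (fun z => S.cycle_le_zpow p) k
    rw [Function.iterate_succ_apply'] at h
    have := S.zpow_le_slideWith_of_zpow_le_cycle p q hk h
    rw [Function.iterate_succ_apply]
    refine ih (S.slideWith_le_zpow p q hy) ?_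
    rwa [Function.Commute.iterate_right (show Function.Commute (S.slideWith p q) (S.cycle p) from
      S.slideWith_cycle p q) k y] at this

/-! ### Sliding circuits lie in the super summit set -/

theorem inf_iterate_slide [Nontrivial G] {y : G} {m : ℕ} (hm : 1 ≤ m) (hy : S.slide^[m] y = y)
    (j : ℕ) : S.inf (S.slide^[j] y) = S.inf y := by
  have hmono : Monotone fun i => S.inf (S.slide^[i] y) := monotone_nat_of_le_succ fun i => by
    rw [Function.iterate_succ_apply']
    exact S.inf_le_inf_slide _
  have h1 := hmono (Nat.zero_le j)
  -- The index `m * j` is at least `j` and a multiple of the period, so the nondecreasing infimum is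
  -- squeezed between two equal values.
  have h2 := hmono (Nat.le_mul_of_pos_left j hm)
  have h3 : S.slide^[m * j] y = y := by
    rw [Function.iterate_mul]
    exact Function.iterate_fixed hy j
  simp only [h3, Function.iterate_zero, id] at h1 h2
  exact _root_.le_antisymm h2 h1

theorem iterate_slide_inv [Nontrivial G] (y : G) (j : ℕ) :
    S.slide^[j] y⁻¹ = (S.slide^[j] y)⁻¹ := by
  induction j with
  | zero => rfl
  | succ j ih => simp only [Function.iterate_succ_apply', ih, slide_inv]

theorem sup_iterate_slide [Nontrivial G] {y : G} {m : ℕ} (hm : 1 ≤ m) (hy : S.slide^[m] y = y)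
    (j : ℕ) : S.sup (S.slide^[j] y) = S.sup y := by
  have := S.inf_iterate_slide (y := y⁻¹) hm (by rw [iterate_slide_inv, hy]) j
  rwa [iterate_slide_inv, inf_inv, inf_inv, neg_inj] at this

theorem iterate_slideWith [Nontrivial G] {y : G} {m : ℕ} (hm : 1 ≤ m) (hy : S.slide^[m] y = y)
    (j : ℕ) : (S.slideWith (S.inf y) (S.sup y))^[j] y = S.slide^[j] y := by
  induction j with
  | zero => rfl
  | succ j ih =>
    rw [Function.iterate_succ_apply', Function.iterate_succ_apply', ih, slide_eq,
      S.inf_iterate_slide hm hy, S.sup_iterate_slide hm hy]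

theorem inf_le_inf_of_isConj [Nontrivial G] {y z : G} {m : ℕ} (hm : 1 ≤ m)
    (hy : S.slide^[m] y = y) (hz : IsConj y z) : S.inf z ≤ S.inf y := by
  by_contra! hlt
  obtain ⟨u, rfl⟩ := exists_conjBy_of_isConj hz
  have hu := (S.zpow_le_conjBy_iff _ _ _).1 (S.le_inf_iff.1 (Int.add_one_le_of_lt hlt))
  obtain ⟨-, n, -, hn⟩ := S.exists_zpow_bounds u
  -- Multiplying `u` by `Δ^(-n)` makes it a prefix of `1` without affecting the inequality `hu`.
  obtain ⟨k, hk⟩ := S.exists_zpow_le_iterate_cycle (S.inf y) y (u * S.Δ ^ (-n))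
    (by simpa using hn.mul_zpow (-n)) (by
      have := hu.mul_zpow (-n)
      rwa [mul_assoc, ← zpow_add, add_comm, zpow_add, ← mul_assoc, mul_assoc y] at this)
  have := S.zpow_le_iterate_slideWith (S.inf y) (S.sup y) k (S.sup_le_iff.1 _root_.le_rfl) hk
  rw [S.iterate_slideWith hm hy, ← le_inf_iff, S.inf_iterate_slide hm hy] at this
  omega

theorem sup_le_sup_of_isConj [Nontrivial G] {y z : G} {m : ℕ} (hm : 1 ≤ m)
    (hy : S.slide^[m] y = y) (hz : IsConj y z) : S.sup y ≤ S.sup z := by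
  have hz' : IsConj y⁻¹ z⁻¹ := by
    obtain ⟨c, rfl⟩ := isConj_iff.1 hz
    exact isConj_iff.2 ⟨c, by simp [mul_assoc]⟩
  have := S.inf_le_inf_of_isConj (y := y⁻¹) hm (by rw [iterate_slide_inv, hy]) hz'
  rwa [inf_inv, inf_inv, neg_le_neg_iff] at this

theorem SC_subset_SSS [Nontrivial G] (x : G) : S.SC x ⊆ S.SSS x := by
  rintro y ⟨hxy, m, hm, hy⟩
  refine ⟨hxy, ⟨⟨y, hxy, rfl⟩, ?_⟩, ⟨⟨y, hxy, rfl⟩, ?_⟩⟩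
  · rintro _ ⟨z, hz, rfl⟩
    exact S.inf_le_inf_of_isConj hm hy (hxy.symm.trans hz)
  · rintro _ ⟨z, hz, rfl⟩
    exact S.sup_le_sup_of_isConj hm hy (hxy.symm.trans hz)

/-- The bounds at `v` are extremal in the conjugacy class, so one-sided inequalities force equality.
Membership thereby becomes a pair of `≼` conditions. -/
theorem mem_SSS_iff_of_mem [Nontrivial G] {x v y : G} (hv : v ∈ S.SSS x) :
    y ∈ S.SSS x ↔ IsConj x y ∧ S.le (S.Δ ^ S.inf v) y ∧ S.le y (S.Δ ^ S.sup v) := by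
  obtain ⟨hxv, hinf, hsup⟩ := hv
  rw [← le_inf_iff, ← sup_le_iff]
  constructor
  · rintro ⟨hxy, hinf', hsup'⟩
    exact ⟨hxy, (hinf.unique hinf').le, (hsup.unique hsup').ge⟩
  · rintro ⟨hxy, h1, h2⟩
    have e1 := _root_.le_antisymm (hinf.2 ⟨y, hxy, rfl⟩) h1
    have e2 := _root_.le_antisymm h2 (hsup.2 ⟨y, hxy, rfl⟩)
    exact ⟨hxy, e1 ▸ hinf, e2 ▸ hsup⟩

theorem inf_eq_of_mem_SSS {x v y : G} (hv : v ∈ S.SSS x) (hy : y ∈ S.SSS x) :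
    S.inf y = S.inf v := hy.2.1.unique hv.2.1

theorem sup_eq_of_mem_SSS {x v y : G} (hv : v ∈ S.SSS x) (hy : y ∈ S.SSS x) :
    S.sup y = S.sup v := hy.2.2.unique hv.2.2

theorem slide_mem_SSS [Nontrivial G] {x v : G} (hv : v ∈ S.SSS x) : S.slide v ∈ S.SSS x :=
  (S.mem_SSS_iff_of_mem hv).2 ⟨hv.1.trans (isConj_conjBy _ _),
    S.le_inf_iff.1 (S.inf_le_inf_slide v), S.sup_le_iff.1 (S.sup_slide_le_sup v)⟩

theorem iterate_slide_mem_SSS [Nontrivial G] {x v : G} (hv : v ∈ S.SSS x) (i : ℕ) :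
    S.slide^[i] v ∈ S.SSS x :=
  Function.Iterate.rec (fun z => z ∈ S.SSS x) hv (fun _ => S.slide_mem_SSS) i

theorem conjBy_gcd_mem_SSS [Nontrivial G] {x v u w : G} (hu : conjBy v u ∈ S.SSS x)
    (hw : conjBy v w ∈ S.SSS x) : conjBy v (S.gcd u w) ∈ S.SSS x := by
  have hx : IsConj x (conjBy v (S.gcd u w)) :=
    (hu.1.trans (isConj_conjBy v u).symm).trans (isConj_conjBy _ _)
  have hw' := ((S.mem_SSS_iff_of_mem hu).1 hw).2
  have hu' := ((S.mem_SSS_iff_of_mem hu).1 hu).2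
  refine (S.mem_SSS_iff_of_mem hu).2 ⟨hx, ?_⟩
  -- The conditions become comparisons of `u Δ^n` with `y u`; both expressions commute with `∧` in
  -- `u`.
  rw [zpow_le_conjBy_iff, conjBy_le_zpow_iff] at *
  rw [gcd_mul_zpow, gcd_mul_zpow, mul_gcd]
  exact ⟨le_gcd ((S.gcd_le_left _ _).trans hu'.1) ((S.gcd_le_right _ _).trans hw'.1),
    le_gcd ((S.gcd_le_left _ _).trans hu'.2) ((S.gcd_le_right _ _).trans hw'.2)⟩

theorem conjBy_zpow_mem_SSS [Nontrivial G] {x v : G} (hv : v ∈ S.SSS x) (n : ℤ) :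
    conjBy v (S.Δ ^ n) ∈ S.SSS x := by
  refine (S.mem_SSS_iff_of_mem hv).2 ⟨hv.1.trans (isConj_conjBy _ _), ?_⟩
  have h := ((S.mem_SSS_iff_of_mem hv).1 hv).2
  rw [zpow_le_conjBy_iff, conjBy_le_zpow_iff, (Commute.refl S.Δ).zpow_zpow n,
    (Commute.refl S.Δ).zpow_zpow n]
  exact ⟨h.1.mul_zpow n, h.2.mul_zpow n⟩

/-! ### Transport -/

theorem conjBy_slide_transport (v u : G) :
    conjBy (S.slide v) (S.transport v u) = S.slide (conjBy v u) := by
  simp [slide, transport, conjBy, mul_assoc]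

theorem conjBy_iterate_slide_iterTransport (v u : G) (i : ℕ) :
    conjBy (S.slide^[i] v) (S.iterTransport v u i) = S.slide^[i] (conjBy v u) := by
  induction i with
  | zero => rfl
  | succ i ih =>
    rw [Function.iterate_succ_apply', Function.iterate_succ_apply', ← ih, iterTransport,
      conjBy_slide_transport]

theorem transport_eq {x v u : G} (hv : v ∈ S.SSS x) (hu : conjBy v u ∈ S.SSS x) :
    S.transport v u =
      (S.preferredPrefix v)⁻¹ * (u * S.prefixWith (S.inf v) (S.sup v) (conjBy v u)) := by
  rw [transport, preferredPrefix_eq S (conjBy v u), S.inf_eq_of_mem_SSS hv hu,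
    S.sup_eq_of_mem_SSS hv hu, mul_assoc]

theorem transport_mono {x v u w : G} (hv : v ∈ S.SSS x) (hu : conjBy v u ∈ S.SSS x)
    (hw : conjBy v w ∈ S.SSS x) (h : S.le u w) : S.le (S.transport v u) (S.transport v w) := by
  rw [S.transport_eq hv hu, S.transport_eq hv hw]
  exact (S.mul_prefixWith_mono _ _ _ h).mul_left _

theorem transport_gcd [Nontrivial G] {x v u w : G} (hv : v ∈ S.SSS x) (hu : conjBy v u ∈ S.SSS x)
    (hw : conjBy v w ∈ S.SSS x) :
    S.transport v (S.gcd u w) = S.gcd (S.transport v u) (S.transport v w) := by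
  rw [S.transport_eq hv hu, S.transport_eq hv hw, S.transport_eq hv (S.conjBy_gcd_mem_SSS hu hw),
    mul_prefixWith_gcd, mul_gcd]

theorem transport_one (v : G) : S.transport v 1 = 1 := by simp [transport, conjBy_one]

theorem transport_zpow [Nontrivial G] {x v : G} (hv : v ∈ S.SSS x) (n : ℤ) :
    S.transport v (S.Δ ^ n) = S.Δ ^ n := by
  have h := S.mul_zpow_prefixWith (S.inf v) (S.sup v) v 1 n
  rw [one_mul, one_mul, conjBy_one, ← preferredPrefix_eq] at h
  rw [S.transport_eq hv (S.conjBy_zpow_mem_SSS hv n), h, inv_mul_cancel_left]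

theorem transport_preferredPrefix (v : G) :
    S.transport v (S.preferredPrefix v) = S.preferredPrefix (S.slide v) := by
  simp [transport, slide]

theorem conjBy_iterTransport_mem_SSS [Nontrivial G] {x v u : G} (hu : conjBy v u ∈ S.SSS x)
    (i : ℕ) : conjBy (S.slide^[i] v) (S.iterTransport v u i) ∈ S.SSS x := by
  rw [conjBy_iterate_slide_iterTransport]
  exact S.iterate_slide_mem_SSS hu i

theorem iterTransport_mono [Nontrivial G] {x v u w : G} (hv : v ∈ S.SSS x)
    (hu : conjBy v u ∈ S.SSS x) (hw : conjBy v w ∈ S.SSS x) (h : S.le u w) (i : ℕ) :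
    S.le (S.iterTransport v u i) (S.iterTransport v w i) := by
  induction i with
  | zero => exact h
  | succ i ih =>
    exact S.transport_mono (S.iterate_slide_mem_SSS hv i) (S.conjBy_iterTransport_mem_SSS hu i)
      (S.conjBy_iterTransport_mem_SSS hw i) ih

theorem iterTransport_gcd [Nontrivial G] {x v u w : G} (hv : v ∈ S.SSS x)
    (hu : conjBy v u ∈ S.SSS x) (hw : conjBy v w ∈ S.SSS x) (i : ℕ) :
    S.iterTransport v (S.gcd u w) i = S.gcd (S.iterTransport v u i) (S.iterTransport v w i) := by
  induction i with
  | zero => rfl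
  | succ i ih =>
    rw [iterTransport, ih]
    exact S.transport_gcd (S.iterate_slide_mem_SSS hv i) (S.conjBy_iterTransport_mem_SSS hu i)
      (S.conjBy_iterTransport_mem_SSS hw i)

theorem iterTransport_one (v : G) (i : ℕ) : S.iterTransport v 1 i = 1 := by
  induction i with
  | zero => rfl
  | succ i ih => rw [iterTransport, ih, transport_one]

theorem iterTransport_zpow [Nontrivial G] {x v : G} (hv : v ∈ S.SSS x) (n : ℤ) (i : ℕ) :
    S.iterTransport v (S.Δ ^ n) i = S.Δ ^ n := by
  induction i with
  | zero => rfl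
  | succ i ih => rw [iterTransport, ih, S.transport_zpow (S.iterate_slide_mem_SSS hv i)]

theorem iterTransport_preferredPrefix (v : G) (i : ℕ) :
    S.iterTransport v (S.preferredPrefix v) i = S.preferredPrefix (S.slide^[i] v) := by
  induction i with
  | zero => rfl
  | succ i ih =>
    rw [iterTransport, ih, transport_preferredPrefix, Function.iterate_succ_apply']

/-! ### Finiteness -/

variable {S} in
theorem IsFiniteType.finite_interval (hfin : S.IsFiniteType) (n : ℕ) :
    {g : G | S.le 1 g ∧ S.le g (S.Δ ^ (n : ℤ))}.Finite := by
  induction n with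
  | zero =>
    refine (Set.finite_singleton (1 : G)).subset fun g hg => ?_
    exact (hg.1.antisymm (by simpa using hg.2)).symm
  | succ n ih =>
    refine (Set.Finite.image2 (· * ·) hfin ih).subset fun g hg => ?_
    have h1 : S.le 1 S.Δ := S.one_le.2 S.Δ_mem
    -- Split off the simple factor `g ∧ Δ`. The rest is below `Δ^n` because `(g ∧ Δ) Δ^n = g Δ^n ∧
    -- Δ^(n+1)`.
    refine ⟨S.gcd g S.Δ, ⟨le_gcd hg.1 h1, S.gcd_le_right _ _⟩, (S.gcd g S.Δ)⁻¹ * g,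
      ⟨?_, ?_⟩, mul_inv_cancel_left _ _⟩
    · exact S.one_le.2 (S.gcd_le_left _ _)
    · rw [← S.mul_le_mul_left_iff (S.gcd g S.Δ), mul_inv_cancel_left, gcd_mul_zpow]
      refine le_gcd ?_ ?_
      · simpa using S.mul_zpow_le_mul_zpow g (Int.natCast_nonneg n)
      · rw [← zpow_one_add, add_comm]
        exact_mod_cast hg.2

theorem exists_le_pow (u : G) : ∃ n : ℕ, S.le u (S.Δ ^ (n : ℤ)) := by
  obtain ⟨-, q, -, hq⟩ := S.exists_zpow_bounds u
  exact ⟨q.toNat, hq.trans (S.zpow_le_zpow (Int.self_le_toNat q))⟩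

/-- Transport is monotone and fixes `1` and `Δ^n`, so it keeps the interval `[1, Δ^n]` stable. -/
theorem finite_range_iterTransport [Nontrivial G] (hfin : S.IsFiniteType) {x v u : G}
    (hv : v ∈ S.SSS x) (hu : conjBy v u ∈ S.SSS x) (hpos : u ∈ S.P) :
    (Set.range (S.iterTransport v u)).Finite := by
  obtain ⟨n, hn⟩ := S.exists_le_pow u
  refine (hfin.finite_interval n).subset ?_
  rintro _ ⟨i, rfl⟩
  constructor
  · have := S.iterTransport_mono hv (by rwa [conjBy_one]) hu (S.one_le.2 hpos) i
    rwa [iterTransport_one] at this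
  · have := S.iterTransport_mono hv hu (S.conjBy_zpow_mem_SSS hv n) hn i
    rwa [S.iterTransport_zpow hv] at this

/-- The conjugating element from `y` to `𝔰^i(y)`. -/
noncomputable def slideProd (y : G) : ℕ → G
  | 0 => 1
  | i + 1 => slideProd y i * S.preferredPrefix (S.slide^[i] y)

theorem slideProd_add (y : G) (i j : ℕ) :
    S.slideProd y (i + j) = S.slideProd y i * S.slideProd (S.slide^[i] y) j := by
  induction j with
  | zero => simp [slideProd]
  | succ j ih =>
    rw [← add_assoc, slideProd, ih, slideProd, ← Function.iterate_add_apply, add_comm j i,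
      mul_assoc]

theorem iterTransport_eq (v u : G) (i : ℕ) :
    S.iterTransport v u i = (S.slideProd v i)⁻¹ * u * S.slideProd (conjBy v u) i := by
  induction i with
  | zero => simp [slideProd, iterTransport]
  | succ i ih =>
    rw [iterTransport, transport, conjBy_iterate_slide_iterTransport, ih, slideProd, slideProd]
    simp only [mul_inv_rev, mul_assoc]

/-- After a common period `d`, transporting by `i` more steps multiplies `u^(d)` on both sides by
the same elements as it does `u`, and these cancel. A repetition is therefore pure periodicity. -/
theorem iterTransport_eq_self_of_add_eq {v u : G} {i d : ℕ} (hv : S.slide^[d] v = v)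
    (hu : S.slide^[d] (conjBy v u) = conjBy v u)
    (h : S.iterTransport v u (d + i) = S.iterTransport v u i) : S.iterTransport v u d = u := by
  rw [iterTransport_eq, iterTransport_eq, slideProd_add, slideProd_add, hv, hu] at h
  rw [iterTransport_eq]
  refine mul_left_cancel (a := (S.slideProd v i)⁻¹)
    (mul_right_cancel (b := S.slideProd (conjBy v u) i) ?_)
  simpa only [mul_inv_rev, mul_assoc] using h

/-- The conjugators into sliding circuits are closed under `∧`. -/
theorem conjBy_gcd_mem_SC [Nontrivial G] (hfin : S.IsFiniteType) {x v u w : G} (hv : v ∈ S.SC x)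
    (hu : conjBy v u ∈ S.SC x) (hw : conjBy v w ∈ S.SC x) (hup : u ∈ S.P) (hwp : w ∈ S.P) :
    conjBy v (S.gcd u w) ∈ S.SC x := by
  have hv' := S.SC_subset_SSS x hv
  have hu' := S.SC_subset_SSS x hu
  have hw' := S.SC_subset_SSS x hw
  obtain ⟨-, m₀, hm₀, hv₀⟩ := hv
  obtain ⟨-, m₁, hm₁, hu₁⟩ := hu
  obtain ⟨-, m₂, hm₂, hw₂⟩ := hw
  have hper {m : ℕ} {y : G} (hy : S.slide^[m] y = y) {k : ℕ} (hk : m ∣ k) :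
      S.slide^[k] y = y := by
    obtain ⟨c, rfl⟩ := hk
    rw [Function.iterate_mul]
    exact Function.iterate_fixed hy c
  set M := m₀ * m₁ * m₂ with hM
  have hMpos : 0 < M := Nat.mul_pos (Nat.mul_pos hm₀ hm₁) hm₂
  have hfin' := (S.finite_range_iterTransport hfin hv' hu' hup).prod
    (S.finite_range_iterTransport hfin hv' hw' hwp)
  -- The pigeonhole principle is applied to pairs, so that `u` and `w` return to themselves after
  -- the same number of steps.
  obtain ⟨i, -, j, -, hij, hf⟩ := Set.infinite_univ.exists_lt_map_eq_of_mapsTo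
    (f := fun i : ℕ => (S.iterTransport v u (i * M), S.iterTransport v w (i * M)))
    (fun i _ => Set.mk_mem_prod (Set.mem_range_self _) (Set.mem_range_self _)) hfin'
  obtain ⟨d, rfl⟩ := Nat.exists_eq_add_of_lt hij
  rw [show i + d + 1 = (d + 1) + i by ring, add_mul] at hf
  have hf := Prod.mk.inj hf
  have d0 : m₀ ∣ (d + 1) * M := ((dvd_mul_right m₀ m₁).mul_right m₂).mul_left _
  have d1 : m₁ ∣ (d + 1) * M := ((dvd_mul_left m₁ m₀).mul_right m₂).mul_left _
  have d2 : m₂ ∣ (d + 1) * M := (dvd_mul_left m₂ _).mul_left _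
  have eu := S.iterTransport_eq_self_of_add_eq (hper hv₀ d0) (hper hu₁ d1) hf.1.symm
  have ew := S.iterTransport_eq_self_of_add_eq (hper hv₀ d0) (hper hw₂ d2) hf.2.symm
  refine ⟨(S.conjBy_gcd_mem_SSS hu' hw').1, (d + 1) * M, Nat.mul_pos d.succ_pos hMpos, ?_⟩
  rw [← conjBy_iterate_slide_iterTransport, S.iterTransport_gcd hv' hu' hw', eu, ew,
    hper hv₀ d0]

theorem slide_conjBy_zpow [Nontrivial G] {x v : G} (hv : v ∈ S.SSS x) (n : ℤ) (i : ℕ) :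
    S.slide^[i] (conjBy v (S.Δ ^ n)) = conjBy (S.slide^[i] v) (S.Δ ^ n) := by
  rw [← conjBy_iterate_slide_iterTransport, S.iterTransport_zpow hv]

theorem conjBy_zpow_mem_SC [Nontrivial G] {x v : G} (hv : v ∈ S.SC x) (n : ℤ) :
    conjBy v (S.Δ ^ n) ∈ S.SC x := by
  obtain ⟨hxv, m, hm, hvm⟩ := id hv
  exact ⟨hxv.trans (isConj_conjBy _ _), m, hm,
    by rw [S.slide_conjBy_zpow (S.SC_subset_SSS x hv), hvm]⟩

theorem slide_mem_SC {x v : G} (hv : v ∈ S.SC x) : S.slide v ∈ S.SC x := by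
  obtain ⟨hxv, m, hm, hvm⟩ := hv
  exact ⟨hxv.trans (isConj_conjBy _ _), m, hm,
    by rw [← Function.iterate_succ_apply, Function.iterate_succ_apply', hvm]⟩

theorem preferredPrefix_mem [Nontrivial G] (v : G) : S.preferredPrefix v ∈ S.P := by
  have hi : S.le (S.Δ ^ S.inf v) v := S.le_inf_iff.1 _root_.le_rfl
  have hs : S.le v (S.Δ ^ S.sup v) := S.sup_le_iff.1 _root_.le_rfl
  rw [← one_le]
  refine le_gcd (le_gcd ?_ (S.one_le.2 hs)) (S.one_le.2 S.Δ_mem)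
  simpa using hi.mul_zpow (-S.inf v)

/-! ### Minimal conjugators -/

theorem mem_of_mem_of_le {a u : G} (ha : a ∈ S.P) (h : S.le a u) : u ∈ S.P :=
  S.one_le.1 ((S.one_le.2 ha).trans h)

/-- Existence of a candidate comes from `Δ^n` with `a ≼ Δ^n`, since conjugation by powers of `Δ`
preserves `SSS(x)`. -/
theorem isLeastIn_rho [Nontrivial G] {x v a : G} (hv : v ∈ S.SSS x) (ha : a ∈ S.P) :
    S.IsLeastIn (S.toSSS x v a) (S.rho x v a) := by
  obtain ⟨n, hn⟩ := S.exists_le_pow a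
  exact S.isLeastIn_least (S.exists_isLeastIn ⟨_, hn, S.conjBy_zpow_mem_SSS hv n⟩
    (fun u hu => S.mem_of_mem_of_le ha hu.1)
    fun u hu w hw => ⟨le_gcd hu.1 hw.1, S.conjBy_gcd_mem_SSS hu.2 hw.2⟩)

theorem isLeastIn_cmin [Nontrivial G] (hfin : S.IsFiniteType) {x v a : G} (hv : v ∈ S.SC x)
    (ha : a ∈ S.P) : S.IsLeastIn (S.toSC x v a) (S.cmin x v a) := by
  obtain ⟨n, hn⟩ := S.exists_le_pow a
  exact S.isLeastIn_least (S.exists_isLeastIn ⟨_, hn, S.conjBy_zpow_mem_SC hv n⟩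
    (fun u hu => S.mem_of_mem_of_le ha hu.1)
    fun u hu w hw => ⟨le_gcd hu.1 hw.1, S.conjBy_gcd_mem_SC hfin hv hu.2 hw.2
      (S.mem_of_mem_of_le ha hu.1) (S.mem_of_mem_of_le ha hw.1)⟩)

/-- If an element has no common prefix with the preferred prefix, then no iterated transport of a
nontrivial positive prefix of it is trivial. -/
theorem iterTransport_ne_one [Nontrivial G] {x v r c : G} (hv : v ∈ S.SSS x)
    (hr : conjBy v r ∈ S.SSS x) (hr1 : r ≠ 1) (hrP : r ∈ S.P) (hrc : S.le r c)
    (hc : S.gcd c (S.preferredPrefix v) = 1) (i : ℕ) : S.iterTransport v r i ≠ 1 := by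
  have hslide : conjBy v (S.preferredPrefix v) ∈ S.SSS x := S.slide_mem_SSS hv
  have hgcd : S.gcd r (S.preferredPrefix v) = 1 := by
    refine le.antisymm ?_ (le_gcd (S.one_le.2 hrP) (S.one_le.2 (S.preferredPrefix_mem v)))
    rw [← hc]
    exact le_gcd ((S.gcd_le_left _ _).trans hrc) (S.gcd_le_right _ _)
  induction i with
  | zero => exact hr1
  | succ i ih =>
    intro h
    -- Triviality of the next transport reads `𝔭(v_i) = r^(i) * 𝔭(v_i^(r^(i)))`, so `r^(i) ≼
    -- 𝔭(v_i)`.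
    rw [iterTransport, transport, mul_assoc, inv_mul_eq_one] at h
    have hle : S.le (S.iterTransport v r i) (S.preferredPrefix (S.slide^[i] v)) := by
      rw [h, le, inv_mul_cancel_left]
      exact S.preferredPrefix_mem _
    have := S.iterTransport_gcd hv hr hslide i
    rw [hgcd, iterTransport_one, iterTransport_preferredPrefix, S.gcd_eq_left hle] at this
    exact ih this.symm

/-- The repetition makes the sets defining `i₁` and `i₂` nonempty, so their infima are attained and
`u^(i₁N)` belongs to `F(u)`. -/
theorem exists_circuitTransport_eq_one_of_F_eq {v u : G}
    (h : ∃ i j : ℕ, i < j ∧ S.circuitTransport v u i = S.circuitTransport v u j)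
    (hF : S.F v u = {1}) : ∃ i, S.circuitTransport v u i = 1 := by
  have h1 : ∃ j, S.firstIndex v u < j ∧
      S.circuitTransport v u (S.firstIndex v u) = S.circuitTransport v u j :=
    Nat.sInf_mem (s := {i | ∃ j, i < j ∧ S.circuitTransport v u i = S.circuitTransport v u j}) h
  have h2 : S.firstIndex v u < S.secondIndex v u := (Nat.sInf_mem (s := {j |
    S.firstIndex v u < j ∧
      S.circuitTransport v u (S.firstIndex v u) = S.circuitTransport v u j}) h1).1
  have h3 : S.circuitTransport v u (S.firstIndex v u) ∈ S.F v u :=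
    ⟨_, _root_.le_rfl, h2, rfl⟩
  rw [hF] at h3
  exact ⟨_, h3⟩

end GarsideStructure

theorem corollaryC {G : Type*} [Group G] (S : GarsideStructure G) (hfin : S.IsFiniteType)
    (x v a : G) (hv : v ∈ S.SC x) (ha : S.IsAtom a)
    (hap : ¬ S.le a (S.preferredPrefix v)) :
    -- `ρ_a`, `c_a` and `F(ρ_a)` are well defined
    S.IsLeastIn (S.toSSS x v a) (S.rho x v a) ∧
    S.IsLeastIn (S.toSC x v a) (S.cmin x v a) ∧
    (∃ i j : ℕ, i < j ∧ S.circuitTransport v (S.rho x v a) i =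
      S.circuitTransport v (S.rho x v a) j) ∧
    -- the dichotomy
    (S.F v (S.rho x v a) ≠ {1} ∨ ¬ S.IsIndecomposableConjugator x v (S.cmin x v a)) := by
  obtain ⟨haP, ha1, -⟩ := ha
  have : Nontrivial G := ⟨a, 1, ha1⟩
  have hv' := S.SC_subset_SSS x hv
  have hρ := S.isLeastIn_rho hv' haP
  have hc := S.isLeastIn_cmin hfin hv haP
  have hρP := S.mem_of_mem_of_le haP hρ.1.1
  have hcP := S.mem_of_mem_of_le haP hc.1.1
  have hrep : ∃ i j : ℕ, i < j ∧ S.circuitTransport v (S.rho x v a) i =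
      S.circuitTransport v (S.rho x v a) j := by
    obtain ⟨i, -, j, -, hij, hf⟩ := Set.infinite_univ.exists_lt_map_eq_of_mapsTo
      (f := S.circuitTransport v (S.rho x v a)) (t := Set.range (S.iterTransport v (S.rho x v a)))
      (fun i _ => ⟨_, rfl⟩)
      (S.finite_range_iterTransport hfin hv' hρ.1.2 hρP)
    exact ⟨i, j, hij, hf⟩
  refine ⟨hρ, hc, hrep, ?_⟩
  by_contra! h
  obtain ⟨hF, -, hind⟩ := h
  obtain ⟨i, hi⟩ := S.exists_circuitTransport_eq_one_of_F_eq hrep hF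
  have hρ1 : S.rho x v a ≠ 1 := fun h =>
    ha1 (GarsideStructure.le.antisymm (h ▸ hρ.1.1) (S.one_le.2 haP))
  refine S.iterTransport_ne_one hv' hρ.1.2 hρ1 hρP
    (hρ.2 _ ⟨hc.1.1, S.SC_subset_SSS x hc.1.2⟩) ?_ _ hi
  by_contra hne
  -- A nontrivial `c_a ∧ 𝔭(v)` would decompose `c_a`. It is a proper prefix, since equality would
  -- give `a ≼ c_a ≼ 𝔭(v)`.
  refine hind ⟨_, ⟨GarsideStructure.le_gcd (S.one_le.2 hcP)
    (S.one_le.2 (S.preferredPrefix_mem v)), Ne.symm hne⟩, ⟨S.gcd_le_left _ _, fun h => ?_⟩,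
    S.conjBy_gcd_mem_SC hfin hv hc.1.2 (S.slide_mem_SC hv) hcP (S.preferredPrefix_mem v)⟩
  exact hap (hc.1.1.trans (h ▸ S.gcd_le_right _ _))
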